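/- Let $D\ge 1$ be an integer, let $\beta, M, \sigma > 0$ and $0\le d\le D$ be real, and let $n \ge 1$. Consider the regression model $Y_i = f_0(X_i)+\xi_i$, $i=1,\dots,n$, where the $X_i$ are i.i.d. with law $\mu$ on $[0,1]^D$ and the $\xi_i$ are i.i.d. $N(0,\sigma^2)$, independent of the $X_i$. Let $\mathcal H(\beta,[0,1]^D,M)$ be the set of $f\in C^{k}([0,1]^D)$, where $k$ is the largest integer strictly less than $\beta$, with $$\max_{|\alpha|<k}\ \sup_{x}|\partial^\alpha f(x)| + \max_{|\alpha|=k}\ \sup_{x\ne x'}\frac{|\partial^\alpha f(x)-\partial^\alpha f(x')|}{\|x-x'\|_\infty^{\beta-k}}\le M$$ (suprema over $x,x'\in[0,1]^D$; an empty maximum is $0$). Let $\mathcal P_d$ be the set of probability measures $\mu$ on $[0,1]^D$ whose support satisfies $\dim_{\mathrm M}\operatorname{supp}(\mu)\le d$, where $$\dim_{\mathrm M}E=\inf\Big\{t\ge 0 : \limsup_{\varepsilon\downarrow 0}\mathcal N(E,\varepsilon)\,\varepsilon^{t}=0\Big\}$$ is the upper Minkowski dimension and $\mathcal N(E,\varepsilon)$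 is the least number of $\|\cdot\|_\infty$-balls of radius $\varepsilon$ that cover $E$. Then there is a constant $C'>0$, depending only on $D,\beta,M,d,\sigma$, such that for every $n\ge 1$ $$\inf_{\check f}\ \sup_{(f_0,\mu)\in\mathcal H(\beta,[0,1]^D,M)\times\mathcal P_d} \mathbb E\,\|\check f-f_0\|_{L^2(\mu)}^2\ \ge\ C'\,n^{-2\beta/(2\beta+d)},$$ where the infimum is over all estimators $\check f$, that is, all (jointly measurable) functions $\check f(x)=\check f(x;(X_1,Y_1),\dots,(X_n,Y_n))$ of the point and of the data, the expectation is over the data, and $\|g\|_{L^2(\mu)}^2=\int g^2\,d\mu$. -/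

import Mathlib

open MeasureTheory ProbabilityTheory Filter Topology
open scoped ENNReal NNReal

noncomputable section

/-- The unit cube `[0,1]^D`. The norm on `Fin D → ℝ` is the max-norm `‖·‖_∞`. -/
def unitCube (D : ℕ) : Set (Fin D → ℝ) := Set.Icc 0 1

/-- The (upper) Minkowski dimension: the infimum of the exponents `t ≥ 0` for which
`limsup_{ε ↓ 0} N(E, ε) ε ^ t = 0`, where `N(E, ε)` is the least number of `ε`-balls (in the
ambient metric, with arbitrary centres) covering `E`. -/
def minkowskiDim {X : Type*} [PseudoEMetricSpace X] (E : Set X) : ℝ≥0∞ :=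
  ⨅ (t : ℝ≥0)
    (_ : limsup (fun ε : ℝ≥0 => (Metric.externalCoveringNumber ε E : ℝ≥0∞) * (ε : ℝ≥0∞) ^ (t : ℝ))
      (𝓝[>] 0) = 0), (t : ℝ≥0∞)

/-- The largest integer strictly less than `β` (for `β > 0`). -/
def strictFloor (β : ℝ) : ℕ := ⌈β⌉₊ - 1

/-- The partial derivative `∂_{j 0} ⋯ ∂_{j (m-1)} f (x)` of order `m`, taken within the unit cube.
Since mixed partial derivatives commute, letting `j` range over all words of length `m` in the
coordinates is the same as letting `∂^α f` range over all multi-indices with `|α| = m`. -/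
def cubePartialDeriv {D : ℕ} (f : (Fin D → ℝ) → ℝ) {m : ℕ} (j : Fin m → Fin D)
    (x : Fin D → ℝ) : ℝ :=
  iteratedFDerivWithin ℝ m f (unitCube D) x (fun i => Pi.single (j i) 1)

/-- The Hölder norm of smoothness `β > 0` on the unit cube, with values in `[0, ∞]`, namely
`max_{|α| < k} sup_x |∂^α f x| + max_{|α| = k} sup_{x ≠ y} |∂^α f x - ∂^α f y| / ‖x - y‖_∞ ^ (β - k)`
where `k` is the largest integer strictly less than `β`; an empty maximum is `0`. -/
def holderNorm {D : ℕ} (β : ℝ) (f : (Fin D → ℝ) → ℝ) : ℝ≥0∞ :=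
  (⨆ (m : ℕ) (_ : m < strictFloor β) (j : Fin m → Fin D) (x ∈ unitCube D),
      ENNReal.ofReal |cubePartialDeriv f j x|) +
  (⨆ (j : Fin (strictFloor β) → Fin D) (x ∈ unitCube D) (y ∈ unitCube D) (_ : x ≠ y),
      ENNReal.ofReal
        (|cubePartialDeriv f j x - cubePartialDeriv f j y| / ‖x - y‖ ^ (β - strictFloor β)))

/-- The closed ball of radius `M` in the Hölder space on the unit cube. Functions on the cube are
represented by functions on `ℝ^D`, of which only the values on the cube matter. -/
def holderBall (D : ℕ) (β M : ℝ) : Set ((Fin D → ℝ) → ℝ) :=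
  {f | ContDiffOn ℝ (strictFloor β) f (unitCube D) ∧ holderNorm β f ≤ ENNReal.ofReal M}

/-- The probability measures on `[0,1]^D` whose support has Minkowski dimension at most `d`. -/
def lowDimMeasures (D : ℕ) (d : ℝ) : Set (Measure (Fin D → ℝ)) :=
  {μ | IsProbabilityMeasure μ ∧ μ (unitCube D)ᶜ = 0 ∧ minkowskiDim μ.support ≤ ENNReal.ofReal d}

/-- A sample of `n` covariate-response pairs. -/
abbrev RegressionData (D n : ℕ) : Type := Fin n → (Fin D → ℝ) × ℝ

/-- An estimator: a rule which, given the data and a point, returns the value of the estimated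
function at this point, jointly measurable in the two. -/
def Estimator (D n : ℕ) : Type :=
  {g : RegressionData D n → (Fin D → ℝ) → ℝ // Measurable (Function.uncurry g)}

/-- The expected squared `L²(μ)` error of the estimator `g` of `f`, when it is computed from
`n` i.i.d. observations `(X_i, Y_i)` with `Y_i = f (X_i) + ξ_i`, where `X_i ∼ μ` and
`ξ_i ∼ N(0, σ²)` are independent. -/
def l2Risk {D n : ℕ} (σ : ℝ≥0) (g : Estimator D n) (f : (Fin D → ℝ) → ℝ)
    (μ : Measure (Fin D → ℝ)) : ℝ≥0∞ :=
  ∫⁻ ω : Fin n → (Fin D → ℝ) × ℝ,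
    ∫⁻ x, ENNReal.ofReal ((g.1 (fun i => ((ω i).1, f (ω i).1 + (ω i).2)) x - f x) ^ 2) ∂μ
    ∂(Measure.pi fun _ : Fin n => μ.prod (gaussianReal 0 (σ ^ 2)))

end

/-! The class of design laws restricts the dimension of the support but not its covering numbers at
a fixed scale. The design may therefore depend on `n`: the uniform law on a grid of `N ^ D` points
has finite support, hence dimension zero, yet at scale `1 / N` it looks like a law of full dimension
`D`.

Placing a bump of height `δ = c N ^ (-β)`, or none, at each grid point gives a hypercube of
regression functions in the Hölder ball (`exists_mem_holderBall_gridPoint`). A grid point receives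
about `n / N ^ D` observations; when this is at most `N ^ (2β)`, they cannot reveal whether its bump
is present. Quantitatively, flipping one bump keeps the Hellinger affinity of the two data laws at
least `1 / 2` (`le_affinity_gridMeasure`), so Le Cam's bound `sqeDist_two_point` forces a total
squared error of at least `δ ^ 2 / 8` at that point over the two hypotheses. Averaging over points
and hypercube (`le_two_mul_of_hypercube`) bounds the worst risk below by `δ ^ 2 / 16`.

Taking `N` of order `n ^ (1 / (2β + D))` yields the rate `n ^ (-2β / (2β + D))`, which dominates the
claimed one because `d ≤ D` and `n ≥ 1`. -/

/-! ### Densities of product measures -/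

theorem lintegral_pi_prod_eq_prod_lintegral {E : Type*} [MeasurableSpace E] {n : ℕ}
    (ρ : Fin n → Measure E) [∀ i, SigmaFinite (ρ i)] {f : Fin n → E → ℝ≥0∞}
    (hf : ∀ i, Measurable (f i)) :
    ∫⁻ x, ∏ i, f i (x i) ∂(Measure.pi ρ) = ∏ i, ∫⁻ x, f i x ∂(ρ i) := by
  induction n with
  | zero => simp
  | succ n ih =>
    have hmp := (measurePreserving_piFinSuccAbove ρ 0).symm
    rw [← hmp.lintegral_comp_emb (MeasurableEquiv.measurableEmbedding _)]
    simp only [MeasurableEquiv.piFinSuccAbove_symm_apply, Fin.prod_univ_succ,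
      Fin.insertNthEquiv_zero, Fin.consEquiv_apply, Fin.cons_zero, Fin.cons_succ,
      Fin.zero_succAbove]
    have hm : Measurable fun y : Fin n → E => ∏ i, f i.succ (y i) :=
      Finset.measurable_prod _ fun i _ => (hf _).comp (measurable_pi_apply i)
    rw [lintegral_prod_mul (hf 0).aemeasurable hm.aemeasurable,
      ih (fun i => ρ i.succ) fun i => hf i.succ]

theorem pi_withDensity {E : Type*} [MeasurableSpace E] {n : ℕ}
    (ρ : Measure E) [SigmaFinite ρ] {f : E → ℝ≥0∞} (hf : Measurable f)
    [SigmaFinite (ρ.withDensity f)] :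
    (Measure.pi fun _ : Fin n => ρ.withDensity f) =
      (Measure.pi fun _ : Fin n => ρ).withDensity fun x => ∏ i, f (x i) := by
  refine Measure.pi_eq fun s hs => ?_
  rw [withDensity_apply _ (MeasurableSet.univ_pi hs),
    ← lintegral_indicator (MeasurableSet.univ_pi hs)]
  have : (Set.univ.pi s).indicator (fun x : Fin n → E => ∏ i, f (x i)) =
      fun x => ∏ i, (s i).indicator f (x i) := by
    ext x
    by_cases hx : x ∈ Set.univ.pi s
    · rw [Set.indicator_of_mem hx]
      exact Finset.prod_congr rfl fun i _ => (Set.indicator_of_mem (hx i trivial) _).symm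
    · rw [Set.indicator_of_notMem hx]
      simp only [Set.mem_pi, Set.mem_univ, true_imp_iff, not_forall] at hx
      obtain ⟨i, hi⟩ := hx
      exact (Finset.prod_eq_zero (Finset.mem_univ i) (Set.indicator_of_notMem hi _)).symm
  rw [this, lintegral_pi_prod_eq_prod_lintegral _ fun i => hf.indicator (hs i)]
  exact Finset.prod_congr rfl fun i _ => by
    rw [lintegral_indicator (hs i), withDensity_apply _ (hs i)]

/-! ### Two-point bounds through the Hellinger affinity -/

/-- The pointwise inequality behind the two-point bound `sqeDist_two_point`. -/
theorem mul_sqrt_mul_sqrt_le {a b y p q δ : ℝ} (hp : 0 ≤ p) (hq : 0 ≤ q) (hδ : 0 < δ)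
    (hab : δ ≤ |a - b|) :
    δ * √(p * q) ≤ 2 / δ * ((y - a) ^ 2 * p + (y - b) ^ 2 * q) + δ / 8 * (p + q) := by
  have h1 : √(p * q) = √p * √q := Real.sqrt_mul hp q
  obtain ⟨s, hs, rfl⟩ : ∃ s, 0 ≤ s ∧ p = s ^ 2 := ⟨√p, Real.sqrt_nonneg _, (Real.sq_sqrt hp).symm⟩
  obtain ⟨r, hr, rfl⟩ : ∃ r, 0 ≤ r ∧ q = r ^ 2 := ⟨√q, Real.sqrt_nonneg _, (Real.sq_sqrt hq).symm⟩
  rw [h1, Real.sqrt_sq hs, Real.sqrt_sq hr]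
  have h2 : δ ≤ |y - a| + |y - b| := by
    calc δ ≤ |a - b| := hab
      _ = |(y - b) - (y - a)| := by ring_nf
      _ ≤ |y - b| + |y - a| := abs_sub _ _
      _ = _ := add_comm _ _
  rw [← sq_abs (y - a), ← sq_abs (y - b)]
  set u := |y - a|
  set v := |y - b|
  have h3 : δ * (s * r) ≤ (u + v) * (s * r) := mul_le_mul_of_nonneg_right h2 (by positivity)
  -- The weights are chosen so that the remainders `δ / 8 * (p + q)` integrate to `δ / 4`, half of
  -- the `δ / 2` that an affinity of `1 / 2` supplies on the left.
  have h4 : u * s * r ≤ 2 / δ * (u * s) ^ 2 + δ / 8 * r ^ 2 := by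
    have : 0 ≤ 2 / δ * (u * s - δ / 4 * r) ^ 2 := by positivity
    have e : 2 / δ * (u * s - δ / 4 * r) ^ 2 =
      2 / δ * (u * s) ^ 2 + δ / 8 * r ^ 2 - u * s * r := by field_simp; ring
    linarith
  have h5 : v * r * s ≤ 2 / δ * (v * r) ^ 2 + δ / 8 * s ^ 2 := by
    have : 0 ≤ 2 / δ * (v * r - δ / 4 * s) ^ 2 := by positivity
    have e : 2 / δ * (v * r - δ / 4 * s) ^ 2 =
      2 / δ * (v * r) ^ 2 + δ / 8 * s ^ 2 - v * r * s := by field_simp; ring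
    linarith
  linarith

/-- Le Cam's two-point bound in terms of the Hellinger affinity. -/
theorem sqeDist_two_point {Ω : Type*} [MeasurableSpace Ω] (ρ : Measure Ω) {p q : Ω → ℝ}
    (hp : Measurable p) (hq : Measurable q) (hp0 : ∀ ω, 0 ≤ p ω) (hq0 : ∀ ω, 0 ≤ q ω)
    (hp1 : ∫⁻ ω, ENNReal.ofReal (p ω) ∂ρ = 1) (hq1 : ∫⁻ ω, ENNReal.ofReal (q ω) ∂ρ = 1)
    (haff : ENNReal.ofReal (1 / 2) ≤ ∫⁻ ω, ENNReal.ofReal √(p ω * q ω) ∂ρ)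
    {g : Ω → ℝ} (hg : Measurable g) {a b δ : ℝ} (hδ : 0 < δ) (hab : δ ≤ |a - b|) :
    ENNReal.ofReal (δ ^ 2 / 8) ≤
      ∫⁻ ω, ENNReal.ofReal ((g ω - a) ^ 2) ∂(ρ.withDensity fun ω => ENNReal.ofReal (p ω)) +
      ∫⁻ ω, ENNReal.ofReal ((g ω - b) ^ 2) ∂(ρ.withDensity fun ω => ENNReal.ofReal (q ω)) := by
  rw [lintegral_withDensity_eq_lintegral_mul _ (by fun_prop) (by fun_prop),
    lintegral_withDensity_eq_lintegral_mul _ (by fun_prop) (by fun_prop)]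
  set A := ∫⁻ ω, ((fun ω => ENNReal.ofReal (p ω)) * fun ω => ENNReal.ofReal ((g ω - a) ^ 2)) ω ∂ρ
  set B := ∫⁻ ω, ((fun ω => ENNReal.ofReal (q ω)) * fun ω => ENNReal.ofReal ((g ω - b) ^ 2)) ω ∂ρ
  have key : ENNReal.ofReal (δ / 2) ≤
      ENNReal.ofReal (2 / δ) * (A + B) + ENNReal.ofReal (δ / 8) * (1 + 1) := by
    calc ENNReal.ofReal (δ / 2) = ENNReal.ofReal δ * ENNReal.ofReal (1 / 2) := by
          rw [← ENNReal.ofReal_mul hδ.le]; ring_nf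
      _ ≤ ENNReal.ofReal δ * ∫⁻ ω, ENNReal.ofReal √(p ω * q ω) ∂ρ := by gcongr
      _ = ∫⁻ ω, ENNReal.ofReal δ * ENNReal.ofReal √(p ω * q ω) ∂ρ :=
          (lintegral_const_mul _ (by fun_prop)).symm
      _ ≤ ∫⁻ ω, (ENNReal.ofReal (2 / δ) *
            (((fun ω => ENNReal.ofReal (p ω)) * fun ω => ENNReal.ofReal ((g ω - a) ^ 2)) ω +
             ((fun ω => ENNReal.ofReal (q ω)) * fun ω => ENNReal.ofReal ((g ω - b) ^ 2)) ω) +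
            ENNReal.ofReal (δ / 8) * (ENNReal.ofReal (p ω) + ENNReal.ofReal (q ω))) ∂ρ := by
          refine lintegral_mono fun ω => ?_
          have h1 := hp0 ω
          have h2 := hq0 ω
          simp only [Pi.mul_apply]
          rw [← ENNReal.ofReal_mul hδ.le, ← ENNReal.ofReal_mul h1, ← ENNReal.ofReal_mul h2,
            ← ENNReal.ofReal_add (by positivity) (by positivity),
            ← ENNReal.ofReal_add (by positivity) (by positivity),
            ← ENNReal.ofReal_mul (by positivity), ← ENNReal.ofReal_mul (by positivity),
            ← ENNReal.ofReal_add (by positivity) (by positivity)]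
          refine ENNReal.ofReal_le_ofReal ?_
          have := mul_sqrt_mul_sqrt_le (y := g ω) h1 h2 hδ hab
          linarith
      _ = _ := by
          rw [lintegral_add_left (by fun_prop), lintegral_const_mul _ (by fun_prop),
            lintegral_const_mul _ (by fun_prop), lintegral_add_left (by fun_prop),
            lintegral_add_left (by fun_prop), hp1, hq1]
  by_cases hS : A + B = ∞
  · simp [hS]
  lift A + B to ℝ≥0 using hS with S
  rw [← ENNReal.ofReal_coe_nnreal] at key ⊢
  have e : (1 + 1 : ℝ≥0∞) = ENNReal.ofReal 2 := by norm_num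
  rw [e, ← ENNReal.ofReal_mul (by positivity), ← ENNReal.ofReal_mul (by positivity),
    ← ENNReal.ofReal_add (by positivity) (by positivity),
    ENNReal.ofReal_le_ofReal_iff (by positivity)] at key
  refine ENNReal.ofReal_le_ofReal ?_
  have h : δ / 4 ≤ 2 / δ * S := by linarith
  have : δ / 4 * (δ / 2) ≤ 2 / δ * S * (δ / 2) := by gcongr
  have e : 2 / δ * (S : ℝ) * (δ / 2) = S := by field_simp
  nlinarith

/-- The two-point bound for `n` independent observations. -/
theorem sqeDist_two_point_pi {E : Type*} [MeasurableSpace E] (ρ : Measure E) [SigmaFinite ρ]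
    {p q : E → ℝ} (hp : Measurable p) (hq : Measurable q) (hp0 : ∀ ω, 0 ≤ p ω)
    (hq0 : ∀ ω, 0 ≤ q ω)
    (hp1 : ∫⁻ ω, ENNReal.ofReal (p ω) ∂ρ = 1) (hq1 : ∫⁻ ω, ENNReal.ofReal (q ω) ∂ρ = 1) {n : ℕ}
    (haff : ENNReal.ofReal (1 / 2) ≤ (∫⁻ ω, ENNReal.ofReal √(p ω * q ω) ∂ρ) ^ n)
    {g : (Fin n → E) → ℝ} (hg : Measurable g) {a b δ : ℝ} (hδ : 0 < δ) (hab : δ ≤ |a - b|) :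
    ENNReal.ofReal (δ ^ 2 / 8) ≤
      ∫⁻ ω, ENNReal.ofReal ((g ω - a) ^ 2)
        ∂(Measure.pi fun _ => ρ.withDensity fun ω => ENNReal.ofReal (p ω)) +
      ∫⁻ ω, ENNReal.ofReal ((g ω - b) ^ 2)
        ∂(Measure.pi fun _ => ρ.withDensity fun ω => ENNReal.ofReal (q ω)) := by
  have := isFiniteMeasure_withDensity (μ := ρ) (f := fun ω => ENNReal.ofReal (p ω)) (by simp [hp1])
  have := isFiniteMeasure_withDensity (μ := ρ) (f := fun ω => ENNReal.ofReal (q ω)) (by simp [hq1])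
  have hpi : ∀ r : E → ℝ, Measurable r → (∀ x, 0 ≤ r x) →
      ∫⁻ ω : Fin n → E, ENNReal.ofReal (∏ i, r (ω i)) ∂(Measure.pi fun _ => ρ) =
        (∫⁻ x, ENNReal.ofReal (r x) ∂ρ) ^ n := by
    intro r hr hr0
    simp_rw [ENNReal.ofReal_prod_of_nonneg fun i _ => hr0 _]
    rw [lintegral_pi_prod_eq_prod_lintegral _ fun _ => hr.ennreal_ofReal]
    simp
  rw [pi_withDensity ρ hp.ennreal_ofReal, pi_withDensity ρ hq.ennreal_ofReal]
  simp_rw [← ENNReal.ofReal_prod_of_nonneg fun i _ => hp0 _,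
    ← ENNReal.ofReal_prod_of_nonneg fun i _ => hq0 _]
  refine sqeDist_two_point _ (by fun_prop) (by fun_prop)
    (fun ω => Finset.prod_nonneg fun i _ => hp0 _) (fun ω => Finset.prod_nonneg fun i _ => hq0 _)
    ?_ ?_ ?_ hg hδ hab
  · rw [hpi p hp hp0, hp1, one_pow]
  · rw [hpi q hq hq0, hq1, one_pow]
  · simp_rw [← Finset.prod_mul_distrib]
    have e : ∀ ω : Fin n → E, √(∏ i, p (ω i) * q (ω i)) = ∏ i, √(p (ω i) * q (ω i)) := fun ω =>
      Real.sqrt_prod _ fun i _ => mul_nonneg (hp0 _) (hq0 _)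
    simp_rw [e]
    rw [hpi (fun x => √(p x * q x)) (by fun_prop) fun _ => Real.sqrt_nonneg _]
    exact haff

/-! ### Gaussian noise -/

/-- Completing the square: `(y - a)² + (y - b)² = 2 (y - (a + b) / 2)² + (a - b)² / 2`. -/
theorem sqrt_gaussianPDFReal_mul (a b : ℝ) {v : ℝ≥0} (hv : v ≠ 0) (y : ℝ) :
    √(gaussianPDFReal a v y * gaussianPDFReal b v y) =
      Real.exp (-(a - b) ^ 2 / (8 * v)) * gaussianPDFReal ((a + b) / 2) v y := by
  have h0 : (v : ℝ) ≠ 0 := by exact_mod_cast hv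
  rw [Real.sqrt_eq_iff_mul_self_eq
    (mul_nonneg (gaussianPDFReal_nonneg _ _ _) (gaussianPDFReal_nonneg _ _ _))
    (mul_nonneg (Real.exp_pos _).le (gaussianPDFReal_nonneg _ _ _))]
  simp only [gaussianPDFReal]
  have e : ∀ c x x' z z' : ℝ, x + z + (x + z) = x' + z' →
      Real.exp x * (c * Real.exp z) * (Real.exp x * (c * Real.exp z)) =
      c * Real.exp x' * (c * Real.exp z') := by
    intro c x x' z z' h
    have := congrArg Real.exp h
    simp only [Real.exp_add] at this
    linear_combination c ^ 2 * this
  refine (e _ _ _ _ _ ?_).symm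
  field_simp
  ring

theorem lintegral_sqrt_gaussianPDFReal_mul (a b : ℝ) {v : ℝ≥0} (hv : v ≠ 0) :
    ∫⁻ y, ENNReal.ofReal √(gaussianPDFReal a v y * gaussianPDFReal b v y) =
      ENNReal.ofReal (Real.exp (-(a - b) ^ 2 / (8 * v))) := by
  simp_rw [sqrt_gaussianPDFReal_mul a b hv, ENNReal.ofReal_mul (Real.exp_pos _).le]
  rw [lintegral_const_mul _ (measurable_gaussianPDFReal _ _).ennreal_ofReal,
    lintegral_gaussianPDFReal_eq_one _ hv, mul_one]

/-- The law of a covariate-response pair has a density with respect to `μ ⊗ volume`. -/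
theorem map_prod_gaussianReal {X : Type*} [MeasurableSpace X] (μ : Measure X) [SFinite μ]
    {v : ℝ≥0} (hv : v ≠ 0) {f : X → ℝ} (hf : Measurable f) :
    (μ.prod (gaussianReal 0 v)).map (fun z => (z.1, f z.1 + z.2)) =
      (μ.prod volume).withDensity fun z => ENNReal.ofReal (gaussianPDFReal (f z.1) v z.2) := by
  have hpdf : Measurable fun z : X × ℝ => gaussianPDFReal (f z.1) v z.2 :=
    measurable_uncurry_gaussianPDFReal.comp
      ((hf.comp measurable_fst).prodMk (measurable_const.prodMk measurable_snd))
  ext s hs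
  rw [Measure.map_apply (by fun_prop) hs, Measure.prod_apply (by measurability),
    withDensity_apply _ hs, ← lintegral_indicator hs,
    lintegral_prod _ (hpdf.ennreal_ofReal.indicator hs).aemeasurable]
  refine lintegral_congr fun x => ?_
  have hsx : MeasurableSet (Prod.mk x ⁻¹' s) := measurable_prodMk_left hs
  have h1 : Prod.mk x ⁻¹' ((fun z : X × ℝ => (z.1, f z.1 + z.2)) ⁻¹' s) =
      (fun y => f x + y) ⁻¹' (Prod.mk x ⁻¹' s) := rfl
  rw [h1, ← Measure.map_apply (by fun_prop) hsx, gaussianReal_map_const_add, zero_add,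
    gaussianReal_apply _ hv, ← lintegral_indicator hsx]
  rfl

/-! ### Smooth functions in the Hölder ball -/

theorem strictFloor_lt {β : ℝ} (hβ : 0 < β) : (strictFloor β : ℝ) < β := by
  have h : 0 < ⌈β⌉₊ := Nat.ceil_pos.2 hβ
  exact Nat.lt_ceil.1 (by unfold strictFloor; omega)

theorem le_strictFloor_add_one (β : ℝ) : β ≤ strictFloor β + 1 := by
  have h : ⌈β⌉₊ ≤ strictFloor β + 1 := by unfold strictFloor; omega
  exact (Nat.le_ceil β).trans (by exact_mod_cast h)

/-- At distance at most one the Lipschitz bound is the stronger one, since `s ≤ 1`; at larger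
distances boundedness suffices and accounts for the factor `2`. -/
theorem norm_sub_le_rpow_of_lipschitz_of_bounded {E F : Type*} [NormedAddCommGroup E]
    [NormedAddCommGroup F] {G : E → F} {B s : ℝ} (hs : 0 < s) (hs1 : s ≤ 1)
    (hb : ∀ u, ‖G u‖ ≤ B) (hl : ∀ u v, ‖G u - G v‖ ≤ B * ‖u - v‖) (u v : E) :
    ‖G u - G v‖ ≤ 2 * B * ‖u - v‖ ^ s := by
  have hB : 0 ≤ B := (norm_nonneg _).trans (hb u)
  have h0 : 0 ≤ ‖u - v‖ ^ s := Real.rpow_nonneg (norm_nonneg _) _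
  rcases le_total ‖u - v‖ 1 with h | h
  · have h1 : ‖u - v‖ ≤ ‖u - v‖ ^ s := by
      rcases (norm_nonneg (u - v)).eq_or_lt with h2 | h2
      · exact h2 ▸ h0
      · simpa using Real.rpow_le_rpow_of_exponent_ge h2 h hs1
    have h3 := mul_le_mul_of_nonneg_left h1 hB
    have h4 := mul_nonneg hB h0
    linarith [hl u v]
  · have h1 : 1 ≤ ‖u - v‖ ^ s := Real.one_le_rpow h hs.le
    have h3 := mul_le_mul_of_nonneg_left h1 hB
    linarith [norm_sub_le (G u) (G v), hb u, hb v]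

theorem exists_bound_iteratedFDeriv {E F : Type*} [NormedAddCommGroup E] [NormedSpace ℝ E]
    [NormedAddCommGroup F] [NormedSpace ℝ F] {φ : E → F} (hφ : ContDiff ℝ (⊤ : ℕ∞) φ)
    (hc : HasCompactSupport φ) (K : ℕ) :
    ∃ B : ℝ, 0 < B ∧ ∀ m ≤ K, ∀ u, ‖iteratedFDeriv ℝ m φ u‖ ≤ B := by
  have h : ∀ m : ℕ, ∃ B : ℝ, ∀ u, ‖iteratedFDeriv ℝ m φ u‖ ≤ B := fun m =>
    (hc.iteratedFDeriv (𝕜 := ℝ) m).exists_bound_of_continuous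
      (hφ.continuous_iteratedFDeriv (by exact_mod_cast le_top))
  choose B hB using h
  have h0 : ∀ m, 0 ≤ B m := fun m => (norm_nonneg _).trans (hB m 0)
  refine ⟨1 + ∑ m ∈ Finset.range (K + 1), B m,
    add_pos_of_pos_of_nonneg one_pos (Finset.sum_nonneg fun m _ => h0 m), fun m hm u => ?_⟩
  have := Finset.single_le_sum (fun m _ => h0 m) (Finset.mem_range.2 (Nat.lt_succ_of_le hm))
  linarith [hB m u]

/-- Derivatives of a sum of translates of a function with small support, by well separated vectors,
are bounded like those of the function itself. -/
theorem norm_iteratedFDeriv_sum_translates_le {E ι : Type*} [NormedAddCommGroup E]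
    [NormedSpace ℝ E] [Fintype ι] {φ : E → ℝ} (hφ : ContDiff ℝ (⊤ : ℕ∞) φ) {r : ℝ}
    (hsupp : tsupport φ ⊆ Metric.closedBall 0 r) {z : ι → E}
    (hz : ∀ a b, a ≠ b → 2 * r < ‖z a - z b‖) {θ : ι → ℝ} (hθ : ∀ a, |θ a| ≤ 1) {m : ℕ} {B : ℝ}
    (hB : ∀ u, ‖iteratedFDeriv ℝ m φ u‖ ≤ B) (u : E) :
    ‖iteratedFDeriv ℝ m (fun u => ∑ a, θ a * φ (u - z a)) u‖ ≤ B := by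
  classical
  have hcd : ∀ a, ContDiff ℝ m fun u => φ (u - z a) := fun a =>
    (hφ.of_le (by exact_mod_cast le_top)).comp (contDiff_id.sub contDiff_const)
  have e : iteratedFDeriv ℝ m (fun u => ∑ a, θ a * φ (u - z a)) u =
      ∑ a, θ a • iteratedFDeriv ℝ m φ (u - z a) := by
    rw [iteratedFDeriv_fun_sum_apply fun a _ => (contDiff_const.mul (hcd a)).contDiffAt]
    refine Finset.sum_congr rfl fun a _ => ?_
    have := iteratedFDeriv_const_smul_apply (a := θ a) (hcd a).contDiffAt (x := u)
    rw [iteratedFDeriv_comp_sub] at this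
    exact this
  rw [e]
  have hB0 : 0 ≤ B := (norm_nonneg _).trans (hB u)
  have hzero : ∀ a, r < ‖u - z a‖ → iteratedFDeriv ℝ m φ (u - z a) = 0 := by
    intro a ha
    by_contra h
    have := hsupp (support_iteratedFDeriv_subset (𝕜 := ℝ) m (Function.mem_support.2 h))
    rw [mem_closedBall_zero_iff] at this
    linarith
  -- The separation by more than `2 * r` leaves at most one translate active at `u`.
  by_cases h : ∃ a, ‖u - z a‖ ≤ r
  · obtain ⟨a, ha⟩ := h
    rw [Finset.sum_eq_single a]
    · rw [norm_smul, Real.norm_eq_abs]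
      exact (mul_le_of_le_one_left (norm_nonneg _) (hθ a)).trans (hB _)
    · intro b _ hb
      rw [hzero b, smul_zero]
      have h1 := hz b a hb
      have h2 : ‖z b - z a‖ ≤ ‖u - z a‖ + ‖u - z b‖ := by
        calc ‖z b - z a‖ = ‖(u - z a) - (u - z b)‖ := by congr 1; abel
          _ ≤ _ := norm_sub_le _ _
      linarith
    · simp
  · push Not at h
    rw [Finset.sum_eq_zero fun a _ => by rw [hzero a (h a), smul_zero]]
    simpa using hB0

theorem uniqueDiffOn_unitCube (D : ℕ) : UniqueDiffOn ℝ (unitCube D) := by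
  refine uniqueDiffOn_convex (convex_Icc 0 1) ⟨fun _ => 1 / 2, ?_⟩
  have : IsOpen (Set.univ.pi fun _ : Fin D => Set.Ioo (0 : ℝ) 1) :=
    isOpen_set_pi Set.finite_univ fun _ _ => isOpen_Ioo
  refine interior_maximal (fun x hx => ?_) this (fun i _ => by norm_num)
  exact ⟨fun i => (hx i trivial).1.le, fun i => (hx i trivial).2.le⟩

theorem cubePartialDeriv_const_mul_comp_smul {D : ℕ} {F : (Fin D → ℝ) → ℝ}
    (hF : ContDiff ℝ (⊤ : ℕ∞) F) (A N : ℝ) {m : ℕ} (j : Fin m → Fin D) {x : Fin D → ℝ}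
    (hx : x ∈ unitCube D) :
    cubePartialDeriv (fun x => A * F (N • x)) j x =
      A * (N ^ m * iteratedFDeriv ℝ m F (N • x) fun i => Pi.single (j i) 1) := by
  have hFm : ContDiff ℝ m F := hF.of_le (by exact_mod_cast le_top)
  have hs : ContDiff ℝ m fun x => F (N • x) := hFm.comp (contDiff_const_smul N)
  have hf : ContDiff ℝ m fun x => A * F (N • x) := contDiff_const.mul hs
  rw [cubePartialDeriv,
    iteratedFDerivWithin_eq_iteratedFDeriv (uniqueDiffOn_unitCube D) hf.contDiffAt hx]
  have h1 : iteratedFDeriv ℝ m (fun x => A * F (N • x)) x =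
      A • iteratedFDeriv ℝ m (fun x => F (N • x)) x :=
    iteratedFDeriv_const_smul_apply (a := A) hs.contDiffAt
  have h2 := (N • ContinuousLinearMap.id ℝ (Fin D → ℝ)).iteratedFDeriv_comp_right hFm x le_rfl
  have h3 : F ∘ (N • ContinuousLinearMap.id ℝ (Fin D → ℝ)) = fun x => F (N • x) := rfl
  rw [h3] at h2
  rw [h1, h2]
  simp only [smul_apply, smul_eq_mul,
    ContinuousMultilinearMap.compContinuousLinearMap_apply,
    ContinuousLinearMap.id_apply]
  rw [ContinuousMultilinearMap.map_smul_univ]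
  simp

theorem abs_apply_single_le {D m : ℕ}
    (T : ContinuousMultilinearMap ℝ (fun _ : Fin m => Fin D → ℝ) ℝ) (j : Fin m → Fin D) :
    |T fun i => Pi.single (j i) 1| ≤ ‖T‖ := by
  have h := T.le_opNorm fun i => Pi.single (j i) (1 : ℝ)
  rwa [Finset.prod_eq_one fun i _ => by simp [Pi.norm_single], mul_one] at h

/-- A rescaled smooth function with bounded derivatives is in the Hölder ball. -/
theorem const_mul_comp_smul_mem_holderBall {D : ℕ} {β M c B : ℝ} (hβ : 0 < β) (hc : 0 < c)
    {F : (Fin D → ℝ) → ℝ} (hF : ContDiff ℝ (⊤ : ℕ∞) F)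
    (hB : ∀ m ≤ strictFloor β + 1, ∀ u, ‖iteratedFDeriv ℝ m F u‖ ≤ B)
    (hcM : 3 * c * B ≤ M) {N : ℝ} (hN : 1 ≤ N) :
    (fun x => c * N ^ (-β) * F (N • x)) ∈ holderBall D β M := by
  have hN0 : 0 < N := by linarith
  have hB0 : 0 ≤ B := (norm_nonneg _).trans (hB 0 (by omega) 0)
  have hA0 : 0 < c * N ^ (-β) := mul_pos hc (Real.rpow_pos_of_pos hN0 _)
  set k := strictFloor β
  refine ⟨ContDiff.contDiffOn (contDiff_const.mul
    ((hF.of_le (by exact_mod_cast le_top)).comp (contDiff_const_smul N))), ?_⟩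
  have hlip : ∀ u v, ‖iteratedFDeriv ℝ k F u - iteratedFDeriv ℝ k F v‖ ≤ B * ‖u - v‖ := by
    intro u v
    refine Convex.norm_image_sub_le_of_norm_fderiv_le (𝕜 := ℝ) (s := Set.univ) (fun x _ => ?_)
      (fun x _ => ?_) convex_univ trivial trivial
    · exact (hF.differentiable_iteratedFDeriv (by exact_mod_cast ENat.natCast_lt_top k)) x
    · rw [norm_fderiv_iteratedFDeriv]
      exact hB _ le_rfl x
  have hhol := norm_sub_le_rpow_of_lipschitz_of_bounded (s := β - k)
    (by linarith [strictFloor_lt hβ]) (by linarith [le_strictFloor_add_one β])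
    (hB k (by omega)) hlip
  -- The `3` in `hcM` splits as `1` for the derivatives of order below `k` and `2` for the Hölder
  -- seminorm.
  have h1 : ENNReal.ofReal (c * B) + ENNReal.ofReal (2 * (c * B)) ≤ ENNReal.ofReal M := by
    rw [← ENNReal.ofReal_add (by positivity) (by positivity)]
    exact ENNReal.ofReal_le_ofReal (by linarith)
  refine le_trans (add_le_add ?_ ?_) h1
  · refine iSup₂_le fun m hm => iSup_le fun j => iSup₂_le fun x hx => ENNReal.ofReal_le_ofReal ?_
    rw [cubePartialDeriv_const_mul_comp_smul hF _ _ _ hx, abs_mul, abs_mul (N ^ m), abs_of_pos hA0,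
      abs_of_pos (pow_pos hN0 m)]
    have h2 := (abs_apply_single_le (iteratedFDeriv ℝ m F (N • x)) j).trans (hB m (by omega) _)
    have h3 : N ^ (-β) * N ^ m ≤ 1 := by
      rw [← Real.rpow_natCast, ← Real.rpow_add hN0]
      refine Real.rpow_le_one_of_one_le_of_nonpos hN ?_
      have : (m : ℝ) < k := by exact_mod_cast hm
      linarith [strictFloor_lt hβ]
    calc c * N ^ (-β) * (N ^ m * |iteratedFDeriv ℝ m F (N • x) fun i => Pi.single (j i) 1|)
        ≤ c * N ^ (-β) * (N ^ m * B) := by gcongr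
      _ = (N ^ (-β) * N ^ m) * (c * B) := by ring
      _ ≤ 1 * (c * B) := by gcongr
      _ = c * B := one_mul _
  · refine iSup_le fun j => iSup₂_le fun x hx => iSup₂_le fun y hy => iSup_le fun hxy =>
      ENNReal.ofReal_le_ofReal ?_
    have hpos : 0 < ‖x - y‖ := norm_pos_iff.2 (sub_ne_zero.2 hxy)
    rw [div_le_iff₀ (Real.rpow_pos_of_pos hpos _),
      cubePartialDeriv_const_mul_comp_smul hF _ _ _ hx,
      cubePartialDeriv_const_mul_comp_smul hF _ _ _ hy, ← mul_sub, ← mul_sub, abs_mul, abs_mul (N ^ _),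
      abs_of_pos hA0, abs_of_pos (pow_pos hN0 k), ← sub_apply]
    have h2 := (abs_apply_single_le _ j).trans (hhol (N • x) (N • y))
    rw [← smul_sub, norm_smul, Real.norm_of_nonneg hN0.le,
      Real.mul_rpow hN0.le (norm_nonneg _)] at h2
    -- The amplitude `N ^ (-β)` exactly offsets the growth of the Hölder seminorm under dilation by
    -- `N`.
    have h3 : N ^ (-β) * N ^ k * N ^ (β - k) = 1 := by
      rw [← Real.rpow_natCast, ← Real.rpow_add hN0, ← Real.rpow_add hN0]
      simp
    calc _ ≤ c * N ^ (-β) * (N ^ k * (2 * B * (N ^ (β - k) * ‖x - y‖ ^ (β - k)))) := by gcongr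
      _ = (N ^ (-β) * N ^ k * N ^ (β - k)) * (2 * (c * B) * ‖x - y‖ ^ (β - k)) := by ring
      _ = _ := by rw [h3, one_mul]

/-! ### Prescribing values on a regular grid -/

theorem one_le_norm_natCast_sub {D N : ℕ} {a b : Fin D → Fin N} (hab : a ≠ b) :
    1 ≤ ‖(fun i => ((a i : ℕ) : ℝ)) - fun i => ((b i : ℕ) : ℝ)‖ := by
  obtain ⟨i, hi⟩ := Function.ne_iff.1 hab
  refine le_trans ?_ (norm_le_pi_norm _ i)
  have h : ((a i : ℕ) : ℤ) - (b i : ℕ) ≠ 0 := by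
    have := Fin.val_ne_of_ne hi
    omega
  have := Int.one_le_abs h
  rw [Pi.sub_apply, Real.norm_eq_abs]
  exact_mod_cast this

/-- The points of the regular grid with `N ^ D` points in the unit cube. -/
noncomputable def gridPoint {D N : ℕ} (a : Fin D → Fin N) : Fin D → ℝ :=
  fun i => ((a i : ℕ) : ℝ) / N

theorem gridPoint_mem_unitCube {D N : ℕ} (a : Fin D → Fin N) : gridPoint a ∈ unitCube D := by
  refine ⟨fun i => ?_, fun i => ?_⟩
  · simp only [gridPoint, Pi.zero_apply]; positivity
  · have h : ((a i : ℕ) : ℝ) ≤ N := by exact_mod_cast (a i).2.le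
    exact div_le_one_of_le₀ h (by positivity)

/-- Every function on the grid with `N ^ D` points, with values in `[-1, 1]`, times
`c N ^ (-β)`, extends to a smooth function in the Hölder ball. -/
theorem exists_mem_holderBall_gridPoint (D : ℕ) {β M : ℝ} (hβ : 0 < β) (hM : 0 < M) :
    ∃ c₀ : ℝ, 0 < c₀ ∧ ∀ c, 0 < c → c ≤ c₀ → ∀ N : ℕ, 1 ≤ N →
      ∀ θ : (Fin D → Fin N) → ℝ, (∀ a, |θ a| ≤ 1) → ∃ f ∈ holderBall D β M, Continuous f ∧
        ∀ a, f (gridPoint a) = c * (N : ℝ) ^ (-β) * θ a := by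
  -- An outer radius below `1 / 2` separates the bumps centred at distinct integer points, which are
  -- at max-norm distance at least one.
  let φ : ContDiffBump (0 : Fin D → ℝ) := ⟨1 / 4, 1 / 3, by norm_num, by norm_num⟩
  have hφ : ContDiff ℝ (⊤ : ℕ∞) φ := φ.contDiff
  obtain ⟨B, hB0, hB⟩ := exists_bound_iteratedFDeriv hφ φ.hasCompactSupport (strictFloor β + 1)
  refine ⟨M / (3 * B), by positivity, fun c hc hcM N hN θ hθ => ?_⟩
  rw [le_div_iff₀ (by positivity)] at hcM
  have hN1 : (1 : ℝ) ≤ N := by exact_mod_cast hN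
  let z : (Fin D → Fin N) → (Fin D → ℝ) := fun a i => ((a i : ℕ) : ℝ)
  have hz : ∀ a b, a ≠ b → 1 ≤ ‖z a - z b‖ := fun a b hab => one_le_norm_natCast_sub hab
  have hF : ContDiff ℝ (⊤ : ℕ∞) fun u => ∑ a, θ a * φ (u - z a) :=
    ContDiff.sum fun a _ => contDiff_const.mul (hφ.comp (contDiff_id.sub contDiff_const))
  refine ⟨fun x => c * (N : ℝ) ^ (-β) * ∑ a, θ a * φ ((N : ℝ) • x - z a),
    const_mul_comp_smul_mem_holderBall hβ hc hF (fun m hm u =>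
      norm_iteratedFDeriv_sum_translates_le hφ (r := 1 / 3) (by rw [φ.tsupport_eq])
        (fun a b hab => by linarith [hz a b hab]) hθ (hB m hm) u) (by linarith) hN1,
    continuous_const.mul (hF.continuous.comp (continuous_const_smul (N : ℝ))), fun a => ?_⟩
  have hgrid : (N : ℝ) • gridPoint a = z a := by
    ext i
    simp only [gridPoint, Pi.smul_apply, smul_eq_mul, z]
    field_simp
  simp only [hgrid]
  rw [Finset.sum_eq_single a]
  · rw [sub_self, φ.one_of_mem_closedBall (by simpa using φ.rIn_pos.le), mul_one]
  · intro b _ hb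
    rw [φ.zero_of_le_dist, mul_zero]
    rw [dist_zero_right]
    have := hz a b hb.symm
    change 1 / 3 ≤ _
    linarith
  · simp

/-! ### The grid design and its dimension -/

/-- Covering numbers are bounded by the cardinality, so every `t > 0` is admissible in the infimum.
The exponent `t = 0` is not admissible for nonempty `E`, hence the passage to the limit at the end.
-/
theorem minkowskiDim_eq_zero_of_finite {X : Type*} [PseudoEMetricSpace X] {E : Set X}
    (hE : E.Finite) : minkowskiDim E = 0 := by
  have hcov : ∀ ε : ℝ≥0, (Metric.externalCoveringNumber ε E : ℝ≥0∞) ≤ (hE.toFinset.card : ℝ≥0∞) := by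
    intro ε
    have := Metric.externalCoveringNumber_le_encard_self (ε := ε) E
    rw [hE.encard_eq_coe_toFinset_card] at this
    exact_mod_cast ENat.toENNReal_le.2 this
  have hpos : ∀ t : ℝ≥0, 0 < t → minkowskiDim E ≤ t := by
    intro t ht
    refine iInf₂_le (i := t) ?_
    refine Tendsto.limsup_eq (f := 𝓝[>] (0 : ℝ≥0)) ?_
    have h1 : Tendsto (fun ε : ℝ≥0 => (hE.toFinset.card : ℝ≥0∞) * (ε : ℝ≥0∞) ^ (t : ℝ)) (𝓝[>] 0)
        (𝓝 0) := by
      have h2 : Tendsto (fun ε : ℝ≥0 => (ε : ℝ≥0∞) ^ (t : ℝ)) (𝓝[>] 0) (𝓝 0) := by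
        have h3 : Continuous fun ε : ℝ≥0 => (ε : ℝ≥0∞) ^ (t : ℝ) :=
          (ENNReal.continuous_rpow_const).comp ENNReal.continuous_coe
        have := (h3.tendsto 0).mono_left (nhdsWithin_le_nhds (s := Set.Ioi 0))
        simpa [ENNReal.zero_rpow_of_pos (NNReal.coe_pos.2 ht)] using this
      simpa using ENNReal.Tendsto.const_mul h2 (Or.inr (ENNReal.natCast_ne_top _))
    exact tendsto_of_tendsto_of_tendsto_of_le_of_le tendsto_const_nhds h1 (fun _ => zero_le)
      fun ε => mul_le_mul' (hcov ε) le_rfl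
  refine le_antisymm (ENNReal.le_of_forall_pos_le_add fun t ht _ => ?_) zero_le
  simpa using hpos t ht

/-- The uniform distribution on the regular grid with `N ^ D` points in the unit cube. Its support
is finite, so it belongs to `lowDimMeasures D d` for every `d`, and the rate obtained from it is the
one with exponent `2 * β / (2 * β + D)`, which is at least as slow as that for `d ≤ D`. -/
noncomputable def gridMeasure (D N : ℕ) : Measure (Fin D → ℝ) :=
  ((N ^ D : ℕ) : ℝ≥0∞)⁻¹ • ∑ a : Fin D → Fin N, Measure.dirac (gridPoint a)

theorem lintegral_gridMeasure {D N : ℕ} (f : (Fin D → ℝ) → ℝ≥0∞) :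
    ∫⁻ x, f x ∂(gridMeasure D N) =
      ((N ^ D : ℕ) : ℝ≥0∞)⁻¹ * ∑ a : Fin D → Fin N, f (gridPoint a) := by
  simp [gridMeasure]

theorem isProbabilityMeasure_gridMeasure (D : ℕ) {N : ℕ} (hN : 1 ≤ N) :
    IsProbabilityMeasure (gridMeasure D N) := by
  refine ⟨?_⟩
  rw [← lintegral_one, lintegral_gridMeasure]
  have h : N ^ D ≠ 0 := pow_ne_zero _ (by omega)
  simp only [Finset.sum_const, Finset.card_univ, Fintype.card_pi, Fintype.card_fin,
    Finset.prod_const, nsmul_eq_mul, mul_one]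
  exact ENNReal.inv_mul_cancel (by exact_mod_cast h) (ENNReal.natCast_ne_top _)

theorem gridMeasure_mem_lowDimMeasures (D : ℕ) {N : ℕ} (hN : 1 ≤ N) (d : ℝ) :
    gridMeasure D N ∈ lowDimMeasures D d := by
  have hnull : ∀ s : Set (Fin D → ℝ), MeasurableSet s → (∀ a : Fin D → Fin N, gridPoint a ∈ s) →
      gridMeasure D N sᶜ = 0 := by
    intro s hs h
    simp [gridMeasure, Measure.dirac_apply' _ hs.compl, h]
  refine ⟨isProbabilityMeasure_gridMeasure D hN,
    hnull _ measurableSet_Icc gridPoint_mem_unitCube, ?_⟩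
  have hfin := Set.finite_range (gridPoint : (Fin D → Fin N) → Fin D → ℝ)
  have hsub : (gridMeasure D N).support ⊆ Set.range (gridPoint : (Fin D → Fin N) → _) :=
    Measure.support_subset_of_isClosed hfin.isClosed
      (hnull _ hfin.measurableSet fun a => Set.mem_range_self a)
  rw [minkowskiDim_eq_zero_of_finite (hfin.subset hsub)]
  exact zero_le

/-! ### Risk and two-point bounds on the grid design -/

/-- The joint law of `n` independent observations in the regression model. -/
noncomputable def regressionLaw {D : ℕ} (n : ℕ) (v : ℝ≥0) (μ : Measure (Fin D → ℝ))
    (f : (Fin D → ℝ) → ℝ) : Measure (RegressionData D n) :=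
  Measure.pi fun _ => (μ.prod volume).withDensity fun z =>
    ENNReal.ofReal (gaussianPDFReal (f z.1) v z.2)

/-- Decouples the risk into one estimation problem per grid point, and pushes the law of design and
noise forward to the law of the data, where different `f` can be compared through densities. -/
theorem l2Risk_gridMeasure {D n N : ℕ} (hN : 1 ≤ N) {σ : ℝ≥0} (hσ : 0 < σ) (g : Estimator D n)
    {f : (Fin D → ℝ) → ℝ} (hf : Measurable f) :
    l2Risk σ g f (gridMeasure D N) = ((N ^ D : ℕ) : ℝ≥0∞)⁻¹ * ∑ a : Fin D → Fin N,
      ∫⁻ ω, ENNReal.ofReal ((g.1 ω (gridPoint a) - f (gridPoint a)) ^ 2)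
        ∂(regressionLaw n (σ ^ 2) (gridMeasure D N) f) := by
  have := isProbabilityMeasure_gridMeasure D hN
  have hT : Measurable fun z : (Fin D → ℝ) × ℝ => (z.1, f z.1 + z.2) := by fun_prop
  have hmap : (Measure.pi fun _ : Fin n => (gridMeasure D N).prod (gaussianReal 0 (σ ^ 2))).map
      (fun ω i => ((ω i).1, f (ω i).1 + (ω i).2)) =
        regressionLaw n (σ ^ 2) (gridMeasure D N) f := by
    have h2 := fun _ : Fin n => Measure.isProbabilityMeasure_map
      (μ := (gridMeasure D N).prod (gaussianReal 0 (σ ^ 2))) hT.aemeasurable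
    rw [regressionLaw, ← map_prod_gaussianReal _ (by positivity) hf]
    exact Measure.pi_map_pi fun _ => hT.aemeasurable
  have hm : ∀ a : Fin D → Fin N, Measurable fun ω : RegressionData D n =>
      ENNReal.ofReal ((g.1 ω (gridPoint a) - f (gridPoint a)) ^ 2) := by
    intro a
    have : Measurable fun ω => g.1 ω (gridPoint a) :=
      g.2.comp (measurable_id.prodMk measurable_const)
    fun_prop
  have hT' : Measurable fun (ω : RegressionData D n) i => ((ω i).1, f (ω i).1 + (ω i).2) :=
    measurable_pi_lambda _ fun i => hT.comp (measurable_pi_apply i)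
  have hc : ∀ a : Fin D → Fin N, Measurable fun ω : Fin n → (Fin D → ℝ) × ℝ => ENNReal.ofReal
      ((g.1 (fun i => ((ω i).1, f (ω i).1 + (ω i).2)) (gridPoint a) - f (gridPoint a)) ^ 2) :=
    fun a => (hm a).comp hT'
  simp only [l2Risk, lintegral_gridMeasure]
  rw [← hmap, lintegral_const_mul _ (Finset.measurable_fun_sum _ fun a _ => hc a),
    lintegral_finsetSum _ fun a _ => hc a]
  congr 1
  exact Finset.sum_congr rfl fun a _ => (lintegral_map (hm a) hT').symm

theorem measurable_gaussianPDFReal_comp_fst {X : Type*} [MeasurableSpace X] (v : ℝ≥0) {f : X → ℝ}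
    (hf : Measurable f) : Measurable fun z : X × ℝ => gaussianPDFReal (f z.1) v z.2 :=
  measurable_uncurry_gaussianPDFReal.comp
    ((hf.comp measurable_fst).prodMk (measurable_const.prodMk measurable_snd))

/-- The Hellinger affinity of the laws of one observation under two regression functions which
differ at a single point of the grid. -/
theorem le_affinity_gridMeasure {D N : ℕ} (hN : 1 ≤ N) {v : ℝ≥0} (hv : v ≠ 0)
    {f f' : (Fin D → ℝ) → ℝ} (hf : Measurable f) (hf' : Measurable f') (a : Fin D → Fin N)
    (hff' : ∀ b, b ≠ a → f (gridPoint b) = f' (gridPoint b)) :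
    ENNReal.ofReal (1 - (f (gridPoint a) - f' (gridPoint a)) ^ 2 / (8 * v) / (N : ℝ) ^ D) ≤
      ∫⁻ z, ENNReal.ofReal √(gaussianPDFReal (f z.1) v z.2 * gaussianPDFReal (f' z.1) v z.2)
        ∂((gridMeasure D N).prod volume) := by
  classical
  have := isProbabilityMeasure_gridMeasure D hN
  have h1 := measurable_gaussianPDFReal_comp_fst v hf
  have h2 := measurable_gaussianPDFReal_comp_fst v hf'
  have hN0 : (0 : ℝ) < (N : ℝ) ^ D := by
    have : (0 : ℝ) < N := by exact_mod_cast hN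
    positivity
  rw [lintegral_prod _ (by fun_prop)]
  simp only [lintegral_sqrt_gaussianPDFReal_mul _ _ hv]
  rw [lintegral_gridMeasure, ← ENNReal.ofReal_sum_of_nonneg fun _ _ => (Real.exp_pos _).le,
    ← ENNReal.ofReal_natCast, ← ENNReal.ofReal_inv_of_pos (by exact_mod_cast hN0),
    ← ENNReal.ofReal_mul (by positivity)]
  refine ENNReal.ofReal_le_ofReal ?_
  push_cast
  set s := (f (gridPoint a) - f' (gridPoint a)) ^ 2 / (8 * (v : ℝ))
  have hsum : (N : ℝ) ^ D - s ≤
      ∑ b : Fin D → Fin N, Real.exp (-(f (gridPoint b) - f' (gridPoint b)) ^ 2 / (8 * v)) := by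
    have h3 : (N : ℝ) ^ D - s = ∑ b : Fin D → Fin N, (1 - if b = a then s else 0) := by
      simp
    rw [h3]
    -- Only the point `a` contributes a loss, bounded by `exp (-s) ≥ 1 - s`; every other term equals
    -- `1`.
    refine Finset.sum_le_sum fun b _ => ?_
    split_ifs with hb
    · rw [hb, neg_div]
      linarith [Real.add_one_le_exp (-s)]
    · simp [hff' b hb]
  calc 1 - s / (N : ℝ) ^ D = ((N : ℝ) ^ D)⁻¹ * ((N : ℝ) ^ D - s) := by field_simp
    _ ≤ _ := by gcongr

/-- The single-observation affinity is at least `1 - s` with `s = δ² / (8 v N ^ D)`. The condition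
`hnδ` says `n * s ≤ 1 / 2`, so Bernoulli's inequality keeps the `n`-fold affinity above `1 / 2`. -/
theorem two_point_gridMeasure {D n N : ℕ} (hn : 1 ≤ n) (hN : 1 ≤ N) {v : ℝ≥0} (hv : v ≠ 0)
    {f f' : (Fin D → ℝ) → ℝ} (hf : Measurable f) (hf' : Measurable f') (a : Fin D → Fin N)
    (hff' : ∀ b, b ≠ a → f (gridPoint b) = f' (gridPoint b)) {δ : ℝ} (hδ : 0 < δ)
    (hfa : |f (gridPoint a) - f' (gridPoint a)| = δ) (hnδ : n * δ ^ 2 ≤ 4 * v * (N : ℝ) ^ D)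
    (g : Estimator D n) :
    ENNReal.ofReal (δ ^ 2 / 8) ≤
      ∫⁻ ω, ENNReal.ofReal ((g.1 ω (gridPoint a) - f (gridPoint a)) ^ 2)
        ∂(regressionLaw n v (gridMeasure D N) f) +
      ∫⁻ ω, ENNReal.ofReal ((g.1 ω (gridPoint a) - f' (gridPoint a)) ^ 2)
        ∂(regressionLaw n v (gridMeasure D N) f') := by
  have := isProbabilityMeasure_gridMeasure D hN
  have h1 := measurable_gaussianPDFReal_comp_fst v hf
  have h2 := measurable_gaussianPDFReal_comp_fst v hf'
  have hone : ∀ f : (Fin D → ℝ) → ℝ, Measurable f →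
      ∫⁻ z, ENNReal.ofReal (gaussianPDFReal (f z.1) v z.2) ∂((gridMeasure D N).prod volume) = 1 := by
    intro f hf
    rw [lintegral_prod _ (measurable_gaussianPDFReal_comp_fst v hf).ennreal_ofReal.aemeasurable]
    simp [lintegral_gaussianPDFReal_eq_one _ hv]
  have hg : Measurable fun ω => g.1 ω (gridPoint a) :=
    g.2.comp (measurable_id.prodMk measurable_const)
  refine sqeDist_two_point_pi _ h1 h2 (fun z => gaussianPDFReal_nonneg _ _ _)
    (fun z => gaussianPDFReal_nonneg _ _ _) (hone f hf) (hone f' hf') ?_ hg hδ hfa.ge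
  refine le_trans ?_ (pow_le_pow_left' (le_affinity_gridMeasure hN hv hf hf' a hff') n)
  rw [← sq_abs, hfa]
  have hN0 : (0 : ℝ) < (N : ℝ) ^ D := by
    have : (0 : ℝ) < N := by exact_mod_cast hN
    positivity
  have hv0 : (0 : ℝ) < v := by exact_mod_cast pos_iff_ne_zero.2 hv
  set s := δ ^ 2 / (8 * v) / (N : ℝ) ^ D with hs
  have hs0 : 0 ≤ s := by positivity
  have hns : n * s ≤ 1 / 2 := by
    rw [hs, div_div, mul_div_assoc', div_le_iff₀ (by positivity)]
    linarith
  have hn1 : (1 : ℝ) ≤ n := by exact_mod_cast hn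
  have hs1 : s ≤ 1 / 2 := le_trans (by nlinarith) hns
  rw [← ENNReal.ofReal_pow (by linarith)]
  refine ENNReal.ofReal_le_ofReal ?_
  have := one_add_mul_le_pow (a := -s) (by linarith) n
  rw [← sub_eq_add_neg] at this
  linarith

/-! ### Assouad's averaging and the choice of grid size -/

/-- Averaging over the hypercube, as in Assouad's lemma. -/
theorem le_two_mul_of_hypercube {A : Type*} [Fintype A] [DecidableEq A] [Nonempty A]
    {R : A → (A → Bool) → ℝ≥0∞} {L S : ℝ≥0∞}
    (hR : ∀ a θ, L ≤ R a θ + R a (Function.update θ a (!θ a)))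
    (hS : ∀ θ, (Fintype.card A : ℝ≥0∞)⁻¹ * ∑ a, R a θ ≤ S) : L ≤ 2 * S := by
  have hflip : ∀ a, Fintype.card (A → Bool) * L ≤ 2 * ∑ θ, R a θ := by
    intro a
    -- Flipping coordinate `a` permutes the hypercube, so both terms of `hR` have the same sum over
    -- `θ`.
    have hinv : Function.Involutive fun θ : A → Bool => Function.update θ a (!θ a) := by
      intro θ
      simp
    have h1 : ∑ θ, R a (Function.update θ a (!θ a)) = ∑ θ, R a θ :=
      Equiv.sum_comp hinv.toPerm (R a)
    calc Fintype.card (A → Bool) * L = ∑ _θ : A → Bool, L := by simp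
      _ ≤ ∑ θ, (R a θ + R a (Function.update θ a (!θ a))) := Finset.sum_le_sum fun θ _ => hR a θ
      _ = 2 * ∑ θ, R a θ := by rw [Finset.sum_add_distrib, h1, two_mul]
  have hK0 : (Fintype.card (A → Bool) : ℝ≥0∞) ≠ 0 := by exact_mod_cast Fintype.card_ne_zero
  have hm0 : (Fintype.card A : ℝ≥0∞) ≠ 0 := by exact_mod_cast Fintype.card_ne_zero
  refine (ENNReal.mul_le_mul_iff_right hK0 (ENNReal.natCast_ne_top _)).1 ?_
  calc Fintype.card (A → Bool) * L
      = (Fintype.card A : ℝ≥0∞)⁻¹ * ∑ _a : A, Fintype.card (A → Bool) * L := by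
        rw [Finset.sum_const, Finset.card_univ, nsmul_eq_mul, ← mul_assoc,
          ENNReal.inv_mul_cancel hm0 (ENNReal.natCast_ne_top _), one_mul]
    _ ≤ (Fintype.card A : ℝ≥0∞)⁻¹ * ∑ a, 2 * ∑ θ, R a θ := by
        exact mul_le_mul' le_rfl (Finset.sum_le_sum fun a _ => hflip a)
    _ = 2 * ∑ θ, (Fintype.card A : ℝ≥0∞)⁻¹ * ∑ a, R a θ := by
        rw [← Finset.mul_sum, ← Finset.mul_sum, Finset.sum_comm]
        ring
    _ ≤ 2 * ∑ _θ : A → Bool, S := by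
        gcongr with θ
        exact hS θ
    _ = Fintype.card (A → Bool) * (2 * S) := by
        rw [Finset.sum_const, Finset.card_univ, nsmul_eq_mul]
        ring

/-- The minimax risk in terms of the grid size. -/
theorem exists_le_minimax_of_grid (D : ℕ) {β M : ℝ} {σ : ℝ≥0} (hβ : 0 < β) (hM : 0 < M)
    (hσ : 0 < σ) (d : ℝ) :
    ∃ c : ℝ, 0 < c ∧ ∀ n : ℕ, 1 ≤ n → ∀ N : ℕ, 1 ≤ N → (n : ℝ) ≤ (N : ℝ) ^ (2 * β + D) →
      ENNReal.ofReal (c * (N : ℝ) ^ (-(2 * β))) ≤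
        ⨅ g : Estimator D n, ⨆ f ∈ holderBall D β M, ⨆ μ ∈ lowDimMeasures D d, l2Risk σ g f μ := by
  obtain ⟨c₀, hc₀, H⟩ := exists_mem_holderBall_gridPoint D hβ hM
  have hσ' : (0 : ℝ) < σ := by exact_mod_cast hσ
  -- The bound `c₀` keeps the functions in the Hölder ball; `2 * σ` gives `c ^ 2 ≤ 4 * σ ^ 2`, which
  -- `hnδ` needs.
  set c := min c₀ (2 * σ)
  have hc0 : 0 < c := lt_min hc₀ (by positivity)
  have hcσ : c ≤ 2 * σ := min_le_right _ _
  -- Half of the two-point constant `1 / 8`, the other half being lost to averaging over pairs.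
  refine ⟨c ^ 2 / 16, by positivity, fun n hn N hN hnN => le_iInf fun g => ?_⟩
  have hN0 : (0 : ℝ) < N := by exact_mod_cast hN
  have hθ : ∀ (θ : (Fin D → Fin N) → Bool) a, |if θ a then (1 : ℝ) else 0| ≤ 1 := by
    intro θ a
    split_ifs <;> simp
  choose f hf hcont hfa using fun θ : (Fin D → Fin N) → Bool =>
    H c hc0 (min_le_left _ _) N hN (fun a => if θ a then 1 else 0) (hθ θ)
  set δ := c * (N : ℝ) ^ (-β) with hδ
  have hδ0 : 0 < δ := mul_pos hc0 (Real.rpow_pos_of_pos hN0 _)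
  have hδ2 : δ ^ 2 = c ^ 2 * (N : ℝ) ^ (-(2 * β)) := by
    rw [hδ, mul_pow, ← Real.rpow_natCast ((N : ℝ) ^ (-β)), ← Real.rpow_mul hN0.le]
    congr 2
    push_cast
    ring
  have hnδ : n * δ ^ 2 ≤ 4 * ((σ ^ 2 : ℝ≥0) : ℝ) * (N : ℝ) ^ D := by
    have h1 : c ^ 2 ≤ 4 * ((σ ^ 2 : ℝ≥0) : ℝ) := by
      push_cast
      nlinarith
    calc n * δ ^ 2 ≤ (N : ℝ) ^ (2 * β + D) * (c ^ 2 * (N : ℝ) ^ (-(2 * β))) := by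
          rw [hδ2]
          gcongr
      _ = c ^ 2 * ((N : ℝ) ^ (2 * β + D) * (N : ℝ) ^ (-(2 * β))) := by ring
      _ = c ^ 2 * (N : ℝ) ^ D := by
          rw [← Real.rpow_add hN0, ← Real.rpow_natCast (N : ℝ) D]
          ring_nf
      _ ≤ _ := by gcongr
  have : Nonempty (Fin N) := ⟨⟨0, hN⟩⟩
  have key := le_two_mul_of_hypercube (L := ENNReal.ofReal (δ ^ 2 / 8))
    (S := ⨆ f ∈ holderBall D β M, ⨆ μ ∈ lowDimMeasures D d, l2Risk σ g f μ)
    (R := fun (a : Fin D → Fin N) θ =>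
      ∫⁻ ω, ENNReal.ofReal ((g.1 ω (gridPoint a) - f θ (gridPoint a)) ^ 2)
        ∂(regressionLaw n (σ ^ 2) (gridMeasure D N) (f θ)))
    (fun a θ => by
      refine two_point_gridMeasure hn hN (by positivity) (hcont _).measurable (hcont _).measurable a
        (fun b hb => ?_) hδ0 ?_ hnδ g
      · rw [hfa, hfa, Function.update_of_ne hb]
      · rw [hfa, hfa, Function.update_self]
        cases θ a <;> simp [abs_of_pos hδ0])
    (fun θ => by
      have h1 := l2Risk_gridMeasure hN hσ g (hcont θ).measurable
      have h2 : Fintype.card (Fin D → Fin N) = N ^ D := by simp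
      rw [h2, ← h1]
      exact le_iSup₂_of_le (f θ) (hf θ)
        (le_iSup₂_of_le _ (gridMeasure_mem_lowDimMeasures D hN d) le_rfl))
  have h2 : ENNReal.ofReal (δ ^ 2 / 8) =
      2 * ENNReal.ofReal (c ^ 2 / 16 * (N : ℝ) ^ (-(2 * β))) := by
    rw [hδ2, ← ENNReal.ofReal_ofNat, ← ENNReal.ofReal_mul (by norm_num)]
    ring_nf
  rw [h2] at key
  exact (ENNReal.mul_le_mul_iff_right two_ne_zero ENNReal.ofNat_ne_top).1 key

/-- A grid size whose scale matches the sample size. -/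
theorem exists_nat_rpow {β d D n : ℝ} (hβ : 0 < β) (hd : 0 ≤ d) (hdD : d ≤ D) (hn : 1 ≤ n) :
    ∃ N : ℕ, 1 ≤ N ∧ n ≤ (N : ℝ) ^ (2 * β + D) ∧
      (2 : ℝ) ^ (-(2 * β)) * n ^ (-(2 * β) / (2 * β + d)) ≤ (N : ℝ) ^ (-(2 * β)) := by
  have hn0 : 0 < n := by linarith
  have hD : 0 < 2 * β + D := by linarith
  have hd' : 0 < 2 * β + d := by linarith
  set x := n ^ (1 / (2 * β + D)) with hx
  have hx1 : 1 ≤ x := Real.one_le_rpow hn (by positivity)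
  have hx0 : 0 < x := by linarith
  have hxN : x ≤ ⌈x⌉₊ := Nat.le_ceil x
  -- Since `x ≥ 1`, rounding up costs at most a factor `2`, the source of `2 ^ (-(2 * β))`.
  have hN2 : (⌈x⌉₊ : ℝ) ≤ 2 * x := by linarith [Nat.ceil_lt_add_one hx0.le]
  refine ⟨⌈x⌉₊, Nat.one_le_ceil_iff.2 hx0, ?_, ?_⟩
  · calc n = x ^ (2 * β + D) := by
          rw [hx, ← Real.rpow_mul hn0.le, one_div, inv_mul_cancel₀ hD.ne', Real.rpow_one]
      _ ≤ _ := Real.rpow_le_rpow hx0.le hxN hD.le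
  · calc (2 : ℝ) ^ (-(2 * β)) * n ^ (-(2 * β) / (2 * β + d))
        ≤ (2 : ℝ) ^ (-(2 * β)) * n ^ (-(2 * β) / (2 * β + D)) := by
          gcongr ?_ * ?_
          -- The passage from the exponent with `D` to the one with `d`: for `n ≥ 1` the larger
          -- dimension gives the larger power.
          refine Real.rpow_le_rpow_of_exponent_le hn ?_
          rw [neg_div, neg_div, neg_le_neg_iff]
          gcongr
      _ = (2 * x) ^ (-(2 * β)) := by
          rw [Real.mul_rpow two_pos.le hx0.le, hx, ← Real.rpow_mul hn0.le]
          congr 2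
          ring
      _ ≤ _ := Real.rpow_le_rpow_of_nonpos (lt_of_lt_of_le hx0 hxN) hN2 (by linarith)

theorem mainTheorem4 (D : ℕ) (β M d : ℝ) (σ : ℝ≥0)
    (hβ : 0 < β) (hM : 0 < M) (hd : 0 ≤ d) (hdD : d ≤ D) (hσ : 0 < σ) :
    ∃ C' : ℝ, 0 < C' ∧ ∀ n : ℕ, 1 ≤ n →
      ENNReal.ofReal (C' * (n : ℝ) ^ (-(2 * β) / (2 * β + d))) ≤
        ⨅ g : Estimator D n, ⨆ f ∈ holderBall D β M, ⨆ μ ∈ lowDimMeasures D d, l2Risk σ g f μ := by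
  obtain ⟨c, hc, H⟩ := exists_le_minimax_of_grid D hβ hM hσ d
  refine ⟨c * (2 : ℝ) ^ (-(2 * β)), by positivity, fun n hn => ?_⟩
  obtain ⟨N, hN, hnN, hrate⟩ := exists_nat_rpow hβ hd hdD (n := n) (by exact_mod_cast hn)
  refine le_trans (ENNReal.ofReal_le_ofReal ?_) (H n hn N hN hnN)
  rw [mul_assoc]
  gcongr
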